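/- Let $\mathcal O=\{x\in\mathbb R^2:|x|<1\}$ be the open unit disk, with Lebesgue measure, and let $L^2(\mathcal O)$ be the real Hilbert space of square-integrable functions on $\mathcal O$. For a conductivity $\theta>0$ let $u_\theta$ (smooth in $\mathcal O$, continuous on $\overline{\mathcal O}$) denote the solution of $$\nabla\cdot(\theta\nabla u)=f\ \text{ in }\mathcal O,\qquad u=g\ \text{ on }\partial\mathcal O,\qquad\text{with } f\equiv 2,\quad g(x)=\frac{|x|^2-1}{2},$$ and let $V_\theta:L^2(\mathcal O)\to L^2(\mathcal O)$ be the bounded inverse of $\nabla\cdot(\theta\nabla\,\cdot)$ for Dirichlet boundary conditions: for $F\in L^2(\mathcal O)$, $V_\theta[F]\in H^1_0(\mathcal O)$ is the weak solution $v$ of $\nabla\cdot(\theta\nabla v)=F$ in $\mathcal O$, $v=0$ on $\partial\mathcal O$. Let $\mathbb I_\theta$ be the bounded linear operator on $L^2(\mathcal O)$ that extends $$\mathbb I_\theta(h)=-V_\theta\big[\nabla\cdot(h\nabla u_\theta)\big],\qquad h\in C_c^\infty(\mathcal O).$$ Then for $\theta\equiv 1$ the operator $\mathbb I_1:L^2(\mathcal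 O)\to L^2(\mathcal O)$ exists, is uniquely determined, and is injective on all of $L^2(\mathcal O)$. -/

import Mathlib

open MeasureTheory Filter TopologicalSpace
open scoped Topology ContDiff

noncomputable section

namespace DivForm

variable {d : ℕ}

/-- The real Hilbert space `L²(O)` (Lebesgue measure). -/
abbrev L2 (O : Opens (EuclideanSpace ℝ (Fin d))) : Type :=
  Lp ℝ 2 (volume.restrict (O : Set (EuclideanSpace ℝ (Fin d))))

/-- The Hilbert space of square integrable vector fields on `O`. -/
abbrev L2Vec (O : Opens (EuclideanSpace ℝ (Fin d))) : Type :=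
  Lp (EuclideanSpace ℝ (Fin d)) 2 (volume.restrict (O : Set (EuclideanSpace ℝ (Fin d))))

/-- `C_c^∞(O)`: smooth functions whose support is a compact subset of `O`. -/
abbrev Test (O : Opens (EuclideanSpace ℝ (Fin d))) : Type :=
  TestFunction O ℝ ⊤

/-- The divergence `∑ i, ∂ᵢ Xᵢ` of a vector field. -/
def divergence (X : EuclideanSpace ℝ (Fin d) → EuclideanSpace ℝ (Fin d))
    (x : EuclideanSpace ℝ (Fin d)) : ℝ :=
  ∑ i, (fderiv ℝ X x (EuclideanSpace.single i 1)) i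

/-- `u` is a classical solution, smooth in `O` and continuous up to the boundary, of
`∇ · (θ ∇u) = f` in `O`, `u = g` on `∂O`. Values of `u` off the closure of `O` play no role. -/
structure IsClassicalSolution (O : Opens (EuclideanSpace ℝ (Fin d)))
    (θ f g u : EuclideanSpace ℝ (Fin d) → ℝ) : Prop where
  smooth : ContDiffOn ℝ ∞ u O
  continuous : ContinuousOn u (closure O)
  equation : ∀ x ∈ O, divergence (fun y => θ y • gradient u y) x = f x
  boundary : ∀ x ∈ frontier (O : Set (EuclideanSpace ℝ (Fin d))), u x = g x

/-- `G ∈ L²` is the weak (distributional) gradient of `v ∈ L²` on `O`. -/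
def IsWeakGradient (O : Opens (EuclideanSpace ℝ (Fin d))) (v : L2 O) (G : L2Vec O) : Prop :=
  ∀ (φ : Test O) (i : Fin d),
    ∫ x in (O : Set (EuclideanSpace ℝ (Fin d))), v x * (gradient φ x) i
      = -∫ x in (O : Set (EuclideanSpace ℝ (Fin d))), (G x) i * φ x

/-- `v`, with weak gradient `G`, belongs to `H¹₀(O)`, the closure of `C_c^∞(O)` in `H¹(O)`. -/
structure IsH10 (O : Opens (EuclideanSpace ℝ (Fin d))) (v : L2 O) (G : L2Vec O) : Prop where
  weakGradient : IsWeakGradient O v G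
  approx : ∃ φ : ℕ → Test O,
    Tendsto (fun n => eLpNorm (fun x => v x - φ n x) 2
      (volume.restrict (O : Set (EuclideanSpace ℝ (Fin d))))) atTop (𝓝 0) ∧
    Tendsto (fun n => eLpNorm (fun x => G x - gradient (φ n) x) 2
      (volume.restrict (O : Set (EuclideanSpace ℝ (Fin d))))) atTop (𝓝 0)

/-- `v ∈ H¹₀(O)` solves the homogeneous Dirichlet problem `∇ · (θ ∇v) = F` in `O`, `v = 0` on
`∂O`, the equation being understood against test functions (`θ` bounded and measurable). -/
def IsDirichletSolution (O : Opens (EuclideanSpace ℝ (Fin d)))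
    (θ : EuclideanSpace ℝ (Fin d) → ℝ) (F v : L2 O) : Prop :=
  ∃ G : L2Vec O, IsH10 O v G ∧ ∀ φ : Test O,
    ∫ x in (O : Set (EuclideanSpace ℝ (Fin d))), θ x * inner ℝ (G x) (gradient φ x)
      = -∫ x in (O : Set (EuclideanSpace ℝ (Fin d))), F x * φ x

/-- `V` is the inverse, for Dirichlet boundary conditions, of `∇ · (θ ∇ ·)` on `L²(O)`. -/
def IsDirichletInverse (O : Opens (EuclideanSpace ℝ (Fin d)))
    (θ : EuclideanSpace ℝ (Fin d) → ℝ) (V : L2 O →L[ℝ] L2 O) : Prop :=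
  ∀ F : L2 O, IsDirichletSolution O θ F (V F)

theorem test_memLp (O : Opens (EuclideanSpace ℝ (Fin d))) (h : Test O) :
    MemLp h 2 (volume.restrict (O : Set (EuclideanSpace ℝ (Fin d)))) :=
  (h.continuous.memLp_of_hasCompactSupport h.hasCompactSupport)

theorem contDiff_smul_gradient (O : Opens (EuclideanSpace ℝ (Fin d)))
    {u : EuclideanSpace ℝ (Fin d) → ℝ} (hu : ContDiffOn ℝ ∞ u O) (h : Test O) :
    ContDiff ℝ 1 (fun x => h x • gradient u x) := by
  rw [contDiff_iff_contDiffAt]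
  intro x
  by_cases hx : x ∈ O
  · have h1 : ContDiffAt ℝ ∞ u x := hu.contDiffAt (O.isOpen.mem_nhds hx)
    have h2 : ContDiffAt ℝ 1 (fderiv ℝ u) x := h1.fderiv_right (by norm_cast)
    have h3 : ContDiffAt ℝ 1 (gradient u) x :=
      (InnerProductSpace.toDual ℝ (EuclideanSpace ℝ (Fin d))).symm.contDiff.contDiffAt.comp x h2
    exact ((h.contDiff.of_le (by norm_cast)).contDiffAt).smul h3
  · have h1 : x ∉ tsupport h := fun hh => hx (h.tsupport_subset hh)
    have h2 := notMem_tsupport_iff_eventuallyEq.1 h1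
    refine (contDiffAt_const (c := 0)).congr_of_eventuallyEq ?_
    filter_upwards [h2] with y hy
    simp [hy]

theorem divergence_memLp (O : Opens (EuclideanSpace ℝ (Fin d)))
    {u : EuclideanSpace ℝ (Fin d) → ℝ} (hu : ContDiffOn ℝ ∞ u O) (h : Test O) :
    MemLp (divergence (fun x => h x • gradient u x)) 2
      (volume.restrict (O : Set (EuclideanSpace ℝ (Fin d)))) := by
  have h1 := contDiff_smul_gradient O hu h
  have hs : HasCompactSupport (fun x => h x • gradient u x) := h.hasCompactSupport.smul_right
  have h2 : Continuous (fderiv ℝ (fun x => h x • gradient u x)) :=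
    h1.continuous_fderiv (by norm_num)
  refine Continuous.memLp_of_hasCompactSupport ?_ ?_
  · unfold divergence
    fun_prop
  · refine (hs.fderiv (𝕜 := ℝ)).mono fun x hx => ?_
    contrapose! hx
    simp only [Function.mem_support, not_not] at hx ⊢
    simp [divergence, hx]

/-- The class in `L²(O)` of a test function. -/
def testL2 (O : Opens (EuclideanSpace ℝ (Fin d))) (h : Test O) : L2 O :=
  (test_memLp O h).toLp h

/-- The class in `L²(O)` of `∇ · (h ∇u)`. -/
def divFluxL2 (O : Opens (EuclideanSpace ℝ (Fin d)))
    {u : EuclideanSpace ℝ (Fin d) → ℝ} (hu : ContDiffOn ℝ ∞ u O) (h : Test O) : L2 O :=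
  (divergence_memLp O hu h).toLp (divergence (fun x => h x • gradient u x))

/-- `I` is the bounded linear operator on `L²(O)` that extends
`h ↦ -V_θ[∇ · (h ∇u_θ)]`, `h ∈ C_c^∞(O)`, where `u_θ` solves `∇ · (θ ∇u) = f` in `O`,
`u = g` on `∂O`, and `V_θ` is the inverse of `∇ · (θ ∇ ·)` for Dirichlet boundary conditions. -/
def IsLinearisedMap (O : Opens (EuclideanSpace ℝ (Fin d)))
    (θ f g : EuclideanSpace ℝ (Fin d) → ℝ) (I : L2 O →L[ℝ] L2 O) : Prop :=
  ∃ (u : EuclideanSpace ℝ (Fin d) → ℝ) (hu : IsClassicalSolution O θ f g u)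
    (V : L2 O →L[ℝ] L2 O), IsDirichletInverse O θ V ∧
      ∀ h : Test O, I (testL2 O h) = -V (divFluxL2 O hu.smooth h)

/-- The open unit disk in `ℝ²` centred at the origin. -/
def unitDisk : Opens (EuclideanSpace ℝ (Fin 2)) :=
  ⟨Metric.ball 0 1, Metric.isOpen_ball⟩

end DivForm

end

/-! For these data $u_1=(|x|^2-1)/2$, so $\nabla u_1=x$ and the map is
$h\mapsto-\Delta^{-1}\nabla\cdot(hx)$.

Let $P$ be the $L^2$-closure of the gradients of test functions. The Poincaré inequality makes
$T:\nabla\varphi\mapsto\varphi$ bounded on $P$, and the Dirichlet inverse of the Laplacian is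
$-TT^*$ (`isDirichletSolution_one_iff`). Hence $-\Delta^{-1}\nabla\cdot Y=-T\Pi Y$, with $\Pi$ the
orthogonal projection onto $P$ (`fluxResponse_eq_neg_laplaceInverse`). The right side makes sense
for every square integrable $Y$, which gives the bounded extension with $Y=hx$. It is unique because
test functions are dense and the maximum principle determines $u_1$ on the disk.

For injectivity, $T$ is injective, so $T\Pi(hx)=0$ forces $hx\perp P$, that is $\nabla\cdot(hx)=0$
as a distribution. For a test function $\varphi$ and $r\ge1$ this says that $\int
h(x)\varphi(rx)\,dx$ has zero derivative in $r$. It tends to $0$ as $r\to\infty$, since the support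
of $\varphi(r\,\cdot)$ shrinks to the origin; so $\int h\varphi=0$
(`eq_zero_of_inner_smulPosition_gradLM`). -/

noncomputable section

namespace DivForm

variable {d : ℕ} {O : Opens (EuclideanSpace ℝ (Fin d))}

/-! ### Gradients and integration by parts -/

theorem gradient_apply (f : EuclideanSpace ℝ (Fin d) → ℝ) (x : EuclideanSpace ℝ (Fin d))
    (i : Fin d) : gradient f x i = fderiv ℝ f x (EuclideanSpace.single i 1) := by
  have h : inner ℝ (gradient f x) (EuclideanSpace.single i (1 : ℝ))
      = fderiv ℝ f x (EuclideanSpace.single i 1) := by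
    simp only [gradient, InnerProductSpace.toDual_symm_apply]
  rw [← h, EuclideanSpace.inner_single_right]
  simp

theorem inner_gradient (f : EuclideanSpace ℝ (Fin d) → ℝ) (x v : EuclideanSpace ℝ (Fin d)) :
    inner ℝ v (gradient f x) = fderiv ℝ f x v := by
  rw [real_inner_comm]
  simp only [gradient, InnerProductSpace.toDual_symm_apply]

theorem continuous_gradient {f : EuclideanSpace ℝ (Fin d) → ℝ} (hf : ContDiff ℝ 1 f) :
    Continuous (gradient f) :=
  (InnerProductSpace.toDual ℝ (EuclideanSpace ℝ (Fin d))).symm.continuous.comp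
    (hf.continuous_fderiv (by norm_num))

theorem gradient_eq_zero_of_notMem_tsupport {f : EuclideanSpace ℝ (Fin d) → ℝ}
    {x : EuclideanSpace ℝ (Fin d)} (hx : x ∉ tsupport f) : gradient f x = 0 := by
  have h : fderiv ℝ f x = 0 := by
    by_contra h
    exact hx (support_fderiv_subset ℝ h)
  simp [gradient, h]

theorem hasCompactSupport_gradient {f : EuclideanSpace ℝ (Fin d) → ℝ}
    (hf : HasCompactSupport f) : HasCompactSupport (gradient f) :=
  hf.mono' fun x hx => by
    contrapose! hx
    simpa using gradient_eq_zero_of_notMem_tsupport hx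

theorem fderiv_euclidean_apply {X : EuclideanSpace ℝ (Fin d) → EuclideanSpace ℝ (Fin d)}
    {x : EuclideanSpace ℝ (Fin d)} (hX : DifferentiableAt ℝ X x) (v : EuclideanSpace ℝ (Fin d))
    (i : Fin d) : fderiv ℝ (fun y => X y i) x v = fderiv ℝ X x v i := by
  have h := ((EuclideanSpace.proj (𝕜 := ℝ) i).hasFDerivAt (x := X x)).comp x hX.hasFDerivAt
  rw [show (fun y => X y i) = (EuclideanSpace.proj (𝕜 := ℝ) i) ∘ X from rfl, h.fderiv]
  rfl

/-- Integration by parts: the divergence is minus the formal adjoint of the gradient. -/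
theorem integral_divergence_mul {X : EuclideanSpace ℝ (Fin d) → EuclideanSpace ℝ (Fin d)}
    {φ : EuclideanSpace ℝ (Fin d) → ℝ} (hX : ContDiff ℝ 1 X) (hφ : ContDiff ℝ 1 φ)
    (hc : HasCompactSupport φ) :
    ∫ x, divergence X x * φ x = -∫ x, inner ℝ (X x) (gradient φ x) := by
  have hX' : Continuous (fderiv ℝ X) := hX.continuous_fderiv (by norm_num)
  have hX0 := hX.continuous
  have hφ0 := hφ.continuous
  have hg := continuous_gradient hφ
  -- Compact support of `φ` alone makes all three products integrable; `X` need not decay.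
  have i1 : ∀ i : Fin d, Integrable
      (fun x => fderiv ℝ X x (EuclideanSpace.single i 1) i * φ x) := fun i =>
    Continuous.integrable_of_hasCompactSupport (by fun_prop) hc.mul_left
  have i2 : ∀ i : Fin d, Integrable (fun x => X x i * gradient φ x i) := fun i =>
    Continuous.integrable_of_hasCompactSupport (by fun_prop)
      ((hasCompactSupport_gradient hc).mono fun x hx => by
        contrapose! hx
        simp only [Function.mem_support, not_not] at hx
        simp [hx])
  have i3 : ∀ i : Fin d, Integrable (fun x => X x i * φ x) := fun i =>
    Continuous.integrable_of_hasCompactSupport (by fun_prop) hc.mul_left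
  have key : ∀ i : Fin d, ∫ x, X x i * gradient φ x i
      = -∫ x, fderiv ℝ X x (EuclideanSpace.single i 1) i * φ x := fun i => by
    have hXd : Differentiable ℝ X := hX.differentiable (by norm_num)
    have h := integral_mul_fderiv_eq_neg_fderiv_mul_of_integrable
      (μ := (volume : Measure (EuclideanSpace ℝ (Fin d))))
      (f := fun x => X x i) (g := φ) (v := EuclideanSpace.single i (1 : ℝ))
      (by simpa only [fderiv_euclidean_apply (hXd _)] using i1 i)
      (by simpa only [gradient_apply] using i2 i) (i3 i)
      (fun x _ => (by fun_prop : Differentiable ℝ fun x => X x i) x)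
      (fun x _ => hφ.differentiable (by norm_num) x)
    simpa only [fderiv_euclidean_apply (hXd _), gradient_apply] using h
  simp only [divergence, Finset.sum_mul, PiLp.inner_apply]
  rw [integral_finsetSum _ fun i _ => i1 i]
  have : ∀ x i, inner ℝ (X x i) (gradient φ x i) = X x i * gradient φ x i := fun x i => by
    simp [mul_comm]
  simp only [this]
  rw [integral_finsetSum _ fun i _ => i2 i]
  simp [key]

theorem setIntegral_eq_integral_of_test {F : EuclideanSpace ℝ (Fin d) → ℝ} (φ : Test O)
    (h : ∀ x ∉ tsupport φ, F x = 0) :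
    ∫ x in (O : Set (EuclideanSpace ℝ (Fin d))), F x = ∫ x, F x :=
  setIntegral_eq_integral_of_forall_compl_eq_zero fun x hx =>
    h x fun hx' => hx (φ.tsupport_subset hx')

theorem setIntegral_divergence_mul
    {X : EuclideanSpace ℝ (Fin d) → EuclideanSpace ℝ (Fin d)} (hX : ContDiff ℝ 1 X)
    (φ : Test O) :
    ∫ x in (O : Set (EuclideanSpace ℝ (Fin d))), divergence X x * φ x
      = -∫ x in (O : Set (EuclideanSpace ℝ (Fin d))), inner ℝ (X x) (gradient φ x) := by
  rw [setIntegral_eq_integral_of_test φ, setIntegral_eq_integral_of_test φ]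
  · exact integral_divergence_mul hX (φ.contDiff.of_le (by norm_cast))
      φ.hasCompactSupport
  · intro x hx
    simp [gradient_eq_zero_of_notMem_tsupport hx]
  · intro x hx
    simp [image_eq_zero_of_notMem_tsupport hx]

/-! ### Test functions and weak gradients in $L^2$ -/

theorem test_contDiff_one (φ : Test O) : ContDiff ℝ 1 φ :=
  φ.contDiff.of_le (by norm_cast)

theorem gradient_test_memLp (φ : Test O) :
    MemLp (gradient φ) 2 (volume.restrict (O : Set (EuclideanSpace ℝ (Fin d)))) :=
  (continuous_gradient (test_contDiff_one φ)).memLp_of_hasCompactSupport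
    (hasCompactSupport_gradient φ.hasCompactSupport)

theorem gradient_add_test (φ ψ : Test O) : gradient (φ + ψ : Test O) = gradient φ + gradient ψ := by
  ext1 x
  have h1 := (test_contDiff_one φ).differentiable (by norm_num) x
  have h2 := (test_contDiff_one ψ).differentiable (by norm_num) x
  have h : fderiv ℝ (φ + ψ : Test O) x = fderiv ℝ φ x + fderiv ℝ ψ x := fderiv_add h1 h2
  rw [Pi.add_apply, gradient, h, map_add]
  rfl

theorem gradient_smul_test (c : ℝ) (φ : Test O) : gradient (c • φ : Test O) = c • gradient φ := by
  ext1 x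
  have h1 := (test_contDiff_one φ).differentiable (by norm_num) x
  have h : fderiv ℝ (c • φ : Test O) x = c • fderiv ℝ φ x := fderiv_const_smul h1 c
  rw [Pi.smul_apply, gradient, h, map_smul]
  rfl

/-- The class in `L²(O)` of a test function, as a linear map. -/
def testLM (O : Opens (EuclideanSpace ℝ (Fin d))) : Test O →ₗ[ℝ] L2 O where
  toFun := testL2 O
  map_add' φ ψ := (test_memLp O φ).toLp_add (test_memLp O ψ)
  map_smul' c φ := (test_memLp O φ).toLp_const_smul c

/-- The class in `L²(O)` of the gradient of a test function, as a linear map. -/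
def gradLM (O : Opens (EuclideanSpace ℝ (Fin d))) : Test O →ₗ[ℝ] L2Vec O where
  toFun φ := (gradient_test_memLp φ).toLp (gradient φ)
  map_add' φ ψ := by
    rw [← MemLp.toLp_add]
    exact MemLp.toLp_congr _ _ (by rw [gradient_add_test])
  map_smul' c φ := by
    rw [RingHom.id_apply, ← MemLp.toLp_const_smul]
    exact MemLp.toLp_congr _ _ (by rw [gradient_smul_test])

theorem coeFn_testLM (φ : Test O) :
    testLM O φ =ᵐ[volume.restrict (O : Set (EuclideanSpace ℝ (Fin d)))] φ :=
  (test_memLp O φ).coeFn_toLp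

theorem coeFn_gradLM (φ : Test O) :
    gradLM O φ =ᵐ[volume.restrict (O : Set (EuclideanSpace ℝ (Fin d)))] gradient φ :=
  (gradient_test_memLp φ).coeFn_toLp

theorem inner_testLM (F : L2 O) (φ : Test O) :
    inner ℝ F (testLM O φ) = ∫ x in (O : Set (EuclideanSpace ℝ (Fin d))), F x * φ x := by
  rw [L2.inner_def]
  refine integral_congr_ae ?_
  filter_upwards [coeFn_testLM φ] with x hx
  simp [hx, mul_comm]

theorem inner_gradLM (G : L2Vec O) (φ : Test O) :
    inner ℝ G (gradLM O φ)
      = ∫ x in (O : Set (EuclideanSpace ℝ (Fin d))), inner ℝ (G x) (gradient φ x) := by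
  rw [L2.inner_def]
  refine integral_congr_ae ?_
  filter_upwards [coeFn_gradLM φ] with x hx
  rw [hx]

theorem gradient_test_apply_memLp (φ : Test O) (i : Fin d) :
    MemLp (fun x => gradient φ x i) 2 (volume.restrict (O : Set (EuclideanSpace ℝ (Fin d)))) :=
  (EuclideanSpace.proj (𝕜 := ℝ) i).comp_memLp' (gradient_test_memLp φ)

theorem test_single_memLp (φ : Test O) (i : Fin d) :
    MemLp (fun x => φ x • EuclideanSpace.single i (1 : ℝ)) 2
      (volume.restrict (O : Set (EuclideanSpace ℝ (Fin d)))) :=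
  ((ContinuousLinearMap.id ℝ ℝ).smulRight (EuclideanSpace.single i (1 : ℝ))).comp_memLp'
    (test_memLp O φ)

/-- Each condition becomes a pairing against a fixed $L^2$ element, hence continuous in $(v,G)$;
closedness of the weak gradient relation follows. -/
theorem isWeakGradient_iff {v : L2 O} {G : L2Vec O} : IsWeakGradient O v G ↔
    ∀ (φ : Test O) (i : Fin d), inner ℝ v ((gradient_test_apply_memLp φ i).toLp _)
      = -inner ℝ G ((test_single_memLp φ i).toLp _) := by
  refine forall_congr' fun φ => forall_congr' fun i => ?_
  rw [L2.inner_def, L2.inner_def]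
  have h1 : ∫ x in (O : Set (EuclideanSpace ℝ (Fin d))),
      inner ℝ (v x) ((gradient_test_apply_memLp φ i).toLp _ x)
      = ∫ x in (O : Set (EuclideanSpace ℝ (Fin d))), v x * (gradient φ x) i := by
    refine integral_congr_ae ?_
    filter_upwards [(gradient_test_apply_memLp φ i).coeFn_toLp] with x hx
    simp [hx, mul_comm]
  have h2 : ∫ x in (O : Set (EuclideanSpace ℝ (Fin d))),
      inner ℝ (G x) ((test_single_memLp φ i).toLp _ x)
      = ∫ x in (O : Set (EuclideanSpace ℝ (Fin d))), (G x) i * φ x := by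
    refine integral_congr_ae ?_
    filter_upwards [(test_single_memLp φ i).coeFn_toLp] with x hx
    rw [hx, inner_smul_right, EuclideanSpace.inner_single_right]
    simp [mul_comm]
  rw [h1, h2]

theorem isClosed_setOf_isWeakGradient :
    IsClosed {p : L2 O × L2Vec O | IsWeakGradient O p.1 p.2} := by
  simp only [isWeakGradient_iff, Set.ofPred_forall]
  exact isClosed_iInter fun φ => isClosed_iInter fun i =>
    isClosed_eq (by fun_prop) (by fun_prop)

theorem isWeakGradient_test (ψ : Test O) : IsWeakGradient O (testLM O ψ) (gradLM O ψ) := by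
  intro φ i
  have hX : ContDiff ℝ 1 (fun x => ψ x • EuclideanSpace.single i (1 : ℝ)) :=
    (test_contDiff_one ψ).smul contDiff_const
  have h := setIntegral_divergence_mul hX φ
  have h1 : ∀ x, divergence (fun x => ψ x • EuclideanSpace.single i (1 : ℝ)) x
      = gradient ψ x i := fun x => by
    have hd := (test_contDiff_one ψ).differentiable (by norm_num) x
    simp only [divergence, fderiv_smul_const hd, gradient_apply]
    simp
  have h2 : ∀ x, inner ℝ (ψ x • EuclideanSpace.single i (1 : ℝ)) (gradient φ x)
      = ψ x * gradient φ x i := fun x => by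
    rw [real_inner_smul_left, EuclideanSpace.inner_single_left]
    simp
  simp only [h1, h2] at h
  rw [show ∫ x in (O : Set (EuclideanSpace ℝ (Fin d))), testLM O ψ x * gradient φ x i
      = ∫ x in (O : Set (EuclideanSpace ℝ (Fin d))), ψ x * gradient φ x i from
    integral_congr_ae (by filter_upwards [coeFn_testLM ψ] with x hx; rw [hx]),
    show ∫ x in (O : Set (EuclideanSpace ℝ (Fin d))), gradLM O ψ x i * φ x
      = ∫ x in (O : Set (EuclideanSpace ℝ (Fin d))), gradient ψ x i * φ x from
    integral_congr_ae (by filter_upwards [coeFn_gradLM ψ] with x hx; rw [hx]), h, neg_neg]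

theorem locallyIntegrableOn_L2 (F : L2 O) :
    LocallyIntegrableOn F (O : Set (EuclideanSpace ℝ (Fin d))) volume := by
  rw [locallyIntegrableOn_iff O.isOpen.isLocallyClosed]
  intro K hK hKc
  have h : MemLp F 2 (volume.restrict K) :=
    (Lp.memLp F).mono_measure (Measure.restrict_mono_set _ hK)
  have : IsFiniteMeasure (volume.restrict K) := ⟨by simpa using hKc.measure_lt_top⟩
  exact h.integrable (by norm_num)

theorem eq_zero_of_inner_testLM {F : L2 O} (h : ∀ φ : Test O, inner ℝ F (testLM O φ) = 0) :
    F = 0 := by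
  have h0 := O.isOpen.ae_eq_zero_of_integral_contDiff_smul_eq_zero (locallyIntegrableOn_L2 F)
    fun g hg hc hs => by
      let φ : Test O := ⟨g, hg, hc, hs⟩
      have h1 := h φ
      rw [inner_testLM, setIntegral_eq_integral_of_test φ fun x hx => by
        simp [image_eq_zero_of_notMem_tsupport hx]] at h1
      simpa [mul_comm, φ] using h1
  rw [Lp.eq_zero_iff_ae_eq_zero]
  exact (ae_restrict_iff' O.isOpen.measurableSet).2 h0

/-- Anything orthogonal to all test functions vanishes, by the fundamental lemma of the calculus of
variations. Bounded operators on $L^2$ are thus determined by their values on test functions. -/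
theorem denseRange_testLM : DenseRange (testLM O) := by
  rw [DenseRange, ← LinearMap.coe_range,
    Submodule.dense_iff_topologicalClosure_eq_top, Submodule.topologicalClosure_eq_top_iff,
    Submodule.eq_bot_iff]
  intro F hF
  refine eq_zero_of_inner_testLM fun φ => ?_
  exact (Submodule.mem_orthogonal' _ _).1 hF _ ⟨φ, rfl⟩

/-- The zero function has zero weak gradient. -/
theorem IsWeakGradient.eq_zero {G : L2Vec O} (h : IsWeakGradient O 0 G) : G = 0 := by
  have hi : ∀ i, ((EuclideanSpace.proj (𝕜 := ℝ) i).compLp G : L2 O) = 0 := fun i => by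
    refine eq_zero_of_inner_testLM fun φ => ?_
    have h1 := h φ i
    rw [inner_testLM, integral_congr_ae (g := fun x => G x i * φ x) (by
      filter_upwards [(EuclideanSpace.proj (𝕜 := ℝ) i).coeFn_compLp G] with x hx
      rw [hx]; rfl)]
    rw [integral_congr_ae (g := fun x => 0) (by
      filter_upwards [Lp.coeFn_zero ℝ 2 (volume.restrict (O : Set (EuclideanSpace ℝ (Fin d))))]
        with x hx
      rw [hx]
      simp)] at h1
    simpa using h1.symm
  rw [Lp.eq_zero_iff_ae_eq_zero]
  have h2 : ∀ᵐ x ∂(volume.restrict (O : Set (EuclideanSpace ℝ (Fin d)))), ∀ i, G x i = 0 :=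
    ae_all_iff.2 fun i => by
      filter_upwards [(EuclideanSpace.proj (𝕜 := ℝ) i).coeFn_compLp G,
        (Lp.eq_zero_iff_ae_eq_zero).1 (hi i)] with x h3 h4
      rw [h3] at h4
      exact h4
  filter_upwards [h2] with x hx
  ext i
  simpa using hx i

/-! ### Potential fields and $H^1_0$ -/

/-- The closure in `L²` of the gradients of test functions. -/
def potentialFields (O : Opens (EuclideanSpace ℝ (Fin d))) : Submodule ℝ (L2Vec O) :=
  (LinearMap.range (gradLM O)).topologicalClosure

instance : CompleteSpace (potentialFields O) :=
  (LinearMap.range (gradLM O)).isClosed_topologicalClosure.completeSpace_coe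

theorem gradLM_mem (φ : Test O) : gradLM O φ ∈ potentialFields O :=
  (LinearMap.range (gradLM O)).le_topologicalClosure ⟨φ, rfl⟩

/-- The gradient of test functions, as a map into the closure of its range. -/
def gradPot (O : Opens (EuclideanSpace ℝ (Fin d))) : Test O →ₗ[ℝ] potentialFields O :=
  (gradLM O).codRestrict _ gradLM_mem

theorem denseRange_gradPot : DenseRange (gradPot O) := by
  intro G
  rw [closure_subtype]
  have h : ((↑) : potentialFields O → L2Vec O) '' Set.range (gradPot O)
      = (LinearMap.range (gradLM O) : Set (L2Vec O)) := by
    rw [← Set.range_comp]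
    rfl
  rw [h]
  exact G.2

/-- The Poincaré inequality for test functions. -/
def HasPoincare (O : Opens (EuclideanSpace ℝ (Fin d))) : Prop :=
  ∃ C, ∀ φ : Test O, ‖testLM O φ‖ ≤ C * ‖gradLM O φ‖

/-- The continuous map sending the gradient of a test function to the function itself. -/
def potential (O : Opens (EuclideanSpace ℝ (Fin d))) : potentialFields O →L[ℝ] L2 O :=
  (testLM O).extendOfNorm (gradPot O)

theorem potential_gradPot (hP : HasPoincare O) (φ : Test O) :
    potential O (gradPot O φ) = testLM O φ :=
  LinearMap.extendOfNorm_eq denseRange_gradPot hP φ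

/-- True for gradients of test functions by integration by parts; both sides pass to the limit since
the relation is closed and `potential O` is continuous. -/
theorem isWeakGradient_potential (hP : HasPoincare O) (G : potentialFields O) :
    IsWeakGradient O (potential O G) G := by
  refine denseRange_gradPot.induction_on
    (p := fun G : potentialFields O => IsWeakGradient O (potential O G) G) G ?_ fun φ => ?_
  · exact isClosed_setOf_isWeakGradient.preimage
      ((potential O).continuous.prodMk continuous_subtype_val)
  · rw [potential_gradPot hP]
    exact isWeakGradient_test φ

/-- `G` is the weak gradient of its own potential, and the zero function has only the zero weak
gradient. -/
theorem eq_zero_of_potential_eq_zero (hP : HasPoincare O) {G : potentialFields O}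
    (h : potential O G = 0) : G = 0 := by
  have h1 := isWeakGradient_potential hP G
  rw [h] at h1
  exact Subtype.ext h1.eq_zero

theorem tendsto_testLM_iff {v : L2 O} {φ : ℕ → Test O} :
    Tendsto (fun n => testLM O (φ n)) atTop (𝓝 v) ↔
      Tendsto (fun n => eLpNorm (fun x => v x - φ n x) 2
        (volume.restrict (O : Set (EuclideanSpace ℝ (Fin d))))) atTop (𝓝 0) := by
  rw [Lp.tendsto_Lp_iff_tendsto_eLpNorm']
  refine tendsto_congr fun n => ?_
  rw [eLpNorm_sub_comm]
  refine eLpNorm_congr_ae ?_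
  filter_upwards [coeFn_testLM (φ n)] with x hx
  simp [hx]

theorem tendsto_gradLM_iff {G : L2Vec O} {φ : ℕ → Test O} :
    Tendsto (fun n => gradLM O (φ n)) atTop (𝓝 G) ↔
      Tendsto (fun n => eLpNorm (fun x => G x - gradient (φ n) x) 2
        (volume.restrict (O : Set (EuclideanSpace ℝ (Fin d))))) atTop (𝓝 0) := by
  rw [Lp.tendsto_Lp_iff_tendsto_eLpNorm']
  refine tendsto_congr fun n => ?_
  rw [eLpNorm_sub_comm]
  refine eLpNorm_congr_ae ?_
  filter_upwards [coeFn_gradLM (φ n)] with x hx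
  simp [hx]

/-- Under the Poincaré inequality, `H¹₀` is parametrised by the potential fields. -/
theorem isH10_iff (hP : HasPoincare O) {v : L2 O} {G : L2Vec O} :
    IsH10 O v G ↔ ∃ hG : G ∈ potentialFields O, potential O ⟨G, hG⟩ = v := by
  constructor
  · rintro ⟨-, φ, h1, h2⟩
    rw [← tendsto_testLM_iff] at h1
    rw [← tendsto_gradLM_iff] at h2
    have hG : G ∈ potentialFields O :=
      (LinearMap.range (gradLM O)).isClosed_topologicalClosure.mem_of_tendsto h2
        (Eventually.of_forall fun n => gradLM_mem (φ n))
    refine ⟨hG, tendsto_nhds_unique ?_ h1⟩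
    have h3 : Tendsto (fun n => gradPot O (φ n)) atTop (𝓝 ⟨G, hG⟩) := tendsto_subtype_rng.2 h2
    simpa only [Function.comp_def, potential_gradPot hP] using
      ((potential O).continuous.tendsto _).comp h3
  · rintro ⟨hG, rfl⟩
    obtain ⟨g, hg, hlim⟩ := mem_closure_iff_seq_limit.1 (denseRange_gradPot ⟨G, hG⟩)
    choose φ hφ using hg
    refine ⟨isWeakGradient_potential hP ⟨G, hG⟩, φ, ?_, ?_⟩
    · rw [← tendsto_testLM_iff]
      have h := ((potential O).continuous.tendsto _).comp hlim
      simpa only [Function.comp_def, ← hφ, potential_gradPot hP] using h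
    · rw [← tendsto_gradLM_iff]
      have h := (continuous_subtype_val.tendsto _).comp hlim
      simp only [Function.comp_def, ← hφ] at h
      exact h

theorem eq_of_inner_gradPot {G H : potentialFields O}
    (h : ∀ φ, inner ℝ G (gradPot O φ) = inner ℝ H (gradPot O φ)) : G = H :=
  denseRange_gradPot.eq_of_inner_left ℝ h

/-! ### The Dirichlet inverse of the Laplacian and its action on divergences -/

/-- The solution operator of the Dirichlet problem for the Laplacian. -/
def laplaceInverse (O : Opens (EuclideanSpace ℝ (Fin d))) : L2 O →L[ℝ] L2 O :=
  -(potential O ∘L (potential O).adjoint)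

/-- With $T$ the potential map, the weak equation reads $\langle G,\nabla\varphi\rangle=-\langle
F,T\nabla\varphi\rangle=-\langle T^*F,\nabla\varphi\rangle$. By density of the gradients, $G=-T^*F$,
so $v=TG=-TT^*F$. -/
theorem isDirichletSolution_one_iff (hP : HasPoincare O) {F v : L2 O} :
    IsDirichletSolution O (fun _ => 1) F v ↔ v = laplaceInverse O F := by
  have key : ∀ (G : potentialFields O) (F : L2 O),
      (∀ φ : Test O, ∫ x in (O : Set (EuclideanSpace ℝ (Fin d))),
        1 * inner ℝ ((G : L2Vec O) x) (gradient φ x)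
        = -∫ x in (O : Set (EuclideanSpace ℝ (Fin d))), F x * φ x)
      ↔ G = -(potential O).adjoint F := by
    intro G F
    simp only [one_mul, ← inner_gradLM, ← inner_testLM]
    have h2 : ∀ φ, inner ℝ (-(potential O).adjoint F) (gradPot O φ)
        = -inner ℝ F (testLM O φ) := fun φ => by
      rw [inner_neg_left, ContinuousLinearMap.adjoint_inner_left, potential_gradPot hP]
    constructor
    · intro h
      exact eq_of_inner_gradPot fun φ => by rw [h2, ← h φ]; rfl
    · rintro rfl φ
      rw [← h2]
      rfl
  constructor
  · rintro ⟨G, hG, h⟩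
    obtain ⟨hG', rfl⟩ := (isH10_iff hP).1 hG
    rw [(key ⟨G, hG'⟩ F).1 h]
    simp [laplaceInverse]
  · rintro rfl
    refine ⟨(-(potential O).adjoint F : potentialFields O), (isH10_iff hP).2 ⟨Subtype.prop _, ?_⟩,
      (key _ F).2 rfl⟩
    exact map_neg (potential O) _

theorem isDirichletInverse_one_iff (hP : HasPoincare O) {V : L2 O →L[ℝ] L2 O} :
    IsDirichletInverse O (fun _ => 1) V ↔ V = laplaceInverse O := by
  simp only [IsDirichletInverse, isDirichletSolution_one_iff hP]
  exact ⟨fun h => ContinuousLinearMap.ext h, fun h F => by rw [h]⟩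

/-- `-Δ⁻¹ ∇ · Y` in weak form, for a square integrable field `Y`. -/
def fluxResponse (O : Opens (EuclideanSpace ℝ (Fin d))) : L2Vec O →L[ℝ] L2 O :=
  -(potential O ∘L (potentialFields O).orthogonalProjectionOnto)

/-- The hypothesis says $D=\nabla\cdot Y$ weakly. Pairing with gradients sees only the projection of
$Y$, so $T^*D=-\Pi Y$; then apply $T$. -/
theorem fluxResponse_eq_neg_laplaceInverse (hP : HasPoincare O) {Y : L2Vec O} {D : L2 O}
    (h : ∀ φ : Test O, inner ℝ D (testLM O φ) = -inner ℝ Y (gradLM O φ)) :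
    fluxResponse O Y = -laplaceInverse O D := by
  have h1 : (potential O).adjoint D = -(potentialFields O).orthogonalProjectionOnto Y := by
    refine eq_of_inner_gradPot fun φ => ?_
    rw [ContinuousLinearMap.adjoint_inner_left, potential_gradPot hP, h, inner_neg_left,
      Submodule.inner_orthogonalProjectionOnto_eq_of_mem_right]
    rfl
  simp [fluxResponse, laplaceInverse, h1]

theorem inner_gradLM_eq_zero_of_fluxResponse_eq_zero (hP : HasPoincare O) {Y : L2Vec O}
    (h : fluxResponse O Y = 0) (φ : Test O) : inner ℝ Y (gradLM O φ) = 0 := by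
  have h1 : (potentialFields O).orthogonalProjectionOnto Y = 0 :=
    eq_zero_of_potential_eq_zero hP (by simpa [fluxResponse] using h)
  rw [Submodule.orthogonalProjectionOnto_eq_zero_iff] at h1
  exact (Submodule.mem_orthogonal' _ _).1 h1 _ (gradLM_mem φ)

/-! ### Maximum principle and the explicit classical solution -/

/-- A positive second derivative would make $x$ a local minimum as well, so $f$ would be locally
constant with second derivative $0$. -/
theorem deriv_deriv_nonpos_of_isLocalMax {f : ℝ → ℝ} {x : ℝ} (h : IsLocalMax f x)
    (hc : ContinuousAt f x) : deriv (deriv f) x ≤ 0 := by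
  by_contra! hpos
  have h1 : IsLocalMin f x := isLocalMin_of_deriv_deriv_pos hpos h.deriv_eq_zero hc
  have h2 : f =ᶠ[𝓝 x] fun _ => f x := by
    filter_upwards [h, h1] with y hy hy'
    exact le_antisymm hy hy'
  have h3 := h2.deriv.deriv_eq
  simp only [deriv_const', deriv_const] at h3
  linarith

theorem contDiffAt_gradient {u : EuclideanSpace ℝ (Fin d) → ℝ} {p : EuclideanSpace ℝ (Fin d)}
    (hu : ContDiffAt ℝ 2 u p) : ContDiffAt ℝ 1 (gradient u) p :=
  (InnerProductSpace.toDual ℝ (EuclideanSpace ℝ (Fin d))).symm.contDiff.contDiffAt.comp p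
    (hu.fderiv_right (by norm_num))

/-- Each summand is the second derivative at $0$ of $u$ along a coordinate line through $p$, where
$u$ still has a local maximum. -/
theorem divergence_gradient_nonpos_of_isLocalMax {u : EuclideanSpace ℝ (Fin d) → ℝ}
    {p : EuclideanSpace ℝ (Fin d)} (hu : ContDiffAt ℝ 2 u p) (h : IsLocalMax u p) :
    divergence (gradient u) p ≤ 0 := by
  refine Finset.sum_nonpos fun i _ => ?_
  set e : EuclideanSpace ℝ (Fin d) := EuclideanSpace.single i 1
  let L : ℝ → EuclideanSpace ℝ (Fin d) := fun s => p + s • e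
  have hL : ∀ s, HasDerivAt L e s := fun s => by
    have h := ((hasDerivAt_id s).smul_const e).const_add p
    rwa [one_smul] at h
  have hL0 : L 0 = p := by simp [L]
  have hLc : ContinuousAt L 0 := (hL 0).continuousAt
  have hev : ∀ᶠ y in 𝓝 p, DifferentiableAt ℝ u y := by
    filter_upwards [hu.eventually (by simp)] with y hy
    exact hy.differentiableAt (by norm_num)
  have hLt : Tendsto L (𝓝 0) (𝓝 p) := hL0 ▸ hLc.tendsto
  have h1 : deriv (u ∘ L) =ᶠ[𝓝 0] fun s => gradient u (L s) i := by
    filter_upwards [hLt.eventually hev] with s hs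
    rw [gradient_apply]
    exact (hs.hasFDerivAt.comp_hasDerivAt s (hL s)).deriv
  have hg : DifferentiableAt ℝ (gradient u) p :=
    (contDiffAt_gradient hu).differentiableAt (by norm_num)
  have h2 : HasDerivAt (fun s => gradient u (L s) i) (fderiv ℝ (gradient u) p e i) 0 := by
    have h3 : HasFDerivAt (gradient u) (fderiv ℝ (gradient u) p) (L 0) := by
      rw [hL0]; exact hg.hasFDerivAt
    exact (EuclideanSpace.proj (𝕜 := ℝ) i).hasFDerivAt.comp_hasDerivAt 0
      (h3.comp_hasDerivAt 0 (hL 0))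
  rw [← h2.deriv, ← h1.deriv_eq]
  refine deriv_deriv_nonpos_of_isLocalMax ?_ ?_
  · have h4 : ∀ᶠ s in 𝓝 (0 : ℝ), u (L s) ≤ u p := hLt.eventually h
    simpa only [IsLocalMax, IsMaxFilter, Function.comp_def, hL0] using h4
  · exact ContinuousAt.comp (hL0 ▸ hu.continuousAt) hLc

theorem divergence_add {X Y : EuclideanSpace ℝ (Fin d) → EuclideanSpace ℝ (Fin d)}
    {p : EuclideanSpace ℝ (Fin d)} (hX : DifferentiableAt ℝ X p) (hY : DifferentiableAt ℝ Y p) :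
    divergence (fun x => X x + Y x) p = divergence X p + divergence Y p := by
  simp [divergence, fderiv_fun_add hX hY, Finset.sum_add_distrib]

theorem divergence_sub {X Y : EuclideanSpace ℝ (Fin d) → EuclideanSpace ℝ (Fin d)}
    {p : EuclideanSpace ℝ (Fin d)} (hX : DifferentiableAt ℝ X p) (hY : DifferentiableAt ℝ Y p) :
    divergence (fun x => X x - Y x) p = divergence X p - divergence Y p := by
  simp [divergence, fderiv_fun_sub hX hY, Finset.sum_sub_distrib]

theorem divergence_congr {X Y : EuclideanSpace ℝ (Fin d) → EuclideanSpace ℝ (Fin d)}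
    {p : EuclideanSpace ℝ (Fin d)} (h : X =ᶠ[𝓝 p] Y) : divergence X p = divergence Y p := by
  simp [divergence, h.fderiv_eq]

theorem divergence_const_smul_id (c : ℝ) (p : EuclideanSpace ℝ (Fin d)) :
    divergence (fun x => c • x) p = c * d := by
  simp [divergence, fderiv_fun_const_smul differentiableAt_fun_id, mul_comm]

theorem gradient_norm_sq (c b : ℝ) (x : EuclideanSpace ℝ (Fin d)) :
    gradient (fun x : EuclideanSpace ℝ (Fin d) => c * ‖x‖ ^ 2 + b) x = (2 * c) • x := by
  refine HasGradientAt.gradient ?_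
  rw [hasGradientAt_iff_hasFDerivAt]
  have h := ((hasStrictFDerivAt_norm_sq x).hasFDerivAt.const_mul c).add_const b
  convert! h using 1
  ext v
  simp
  ring

/-- The weak maximum principle for the Laplacian. -/
theorem nonpos_of_harmonic_of_boundary (hd : 0 < d)
    (hO : Bornology.IsBounded (O : Set (EuclideanSpace ℝ (Fin d))))
    {w : EuclideanSpace ℝ (Fin d) → ℝ} (hw : ∀ x ∈ O, ContDiffAt ℝ 2 w x)
    (hc : ContinuousOn w (closure O)) (hΔ : ∀ x ∈ O, divergence (gradient w) x = 0)
    (hb : ∀ x ∈ frontier (O : Set (EuclideanSpace ℝ (Fin d))), w x ≤ 0) :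
    ∀ x ∈ O, w x ≤ 0 := by
  intro x hx
  by_contra! hpos
  obtain ⟨R, hR⟩ := hO.closure.exists_norm_le
  obtain ⟨ε, hε, hεR⟩ : ∃ ε > 0, ε * R ^ 2 < w x := by
    refine ⟨w x / (2 * (R ^ 2 + 1)), by positivity, ?_⟩
    rw [div_mul_eq_mul_div, div_lt_iff₀ (by positivity)]
    nlinarith [sq_nonneg R]
  -- Adding $\varepsilon|y|^2$ makes the Laplacian $2\varepsilon d>0$, which excludes an interior
  -- maximum. At a boundary maximum the sum is at most $\varepsilon R^2<w(x)$, also impossible. The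
  -- `+ 0` matches the form of `gradient_norm_sq`.
  let q : EuclideanSpace ℝ (Fin d) → ℝ := fun y => ε * ‖y‖ ^ 2 + 0
  have hqs : ContDiff ℝ 2 q := by
    have : ContDiff ℝ 2 fun y : EuclideanSpace ℝ (Fin d) => ‖y‖ ^ 2 := contDiff_norm_sq ℝ
    fun_prop
  let z : EuclideanSpace ℝ (Fin d) → ℝ := fun y => w y + q y
  have hz : ContinuousOn z (closure O) := hc.add hqs.continuous.continuousOn
  obtain ⟨p, hp, hmax⟩ := hO.isCompact_closure.exists_isMaxOn ⟨x, subset_closure hx⟩ hz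
  have hzp : w x ≤ z p := by
    have h1 : z x ≤ z p := hmax (subset_closure hx)
    have h2 : w x ≤ z x := by simp only [z, q]; nlinarith [sq_nonneg ‖x‖]
    linarith
  by_cases hpO : p ∈ O
  · have hloc : IsLocalMax z p :=
      hmax.isLocalMax (mem_of_superset (O.isOpen.mem_nhds hpO) subset_closure)
    have h1 := divergence_gradient_nonpos_of_isLocalMax ((hw p hpO).add hqs.contDiffAt) hloc
    have h2 : gradient z =ᶠ[𝓝 p] fun y => gradient w y + gradient q y := by
      filter_upwards [O.isOpen.mem_nhds hpO] with y hy
      have hwy : DifferentiableAt ℝ w y := (hw y hy).differentiableAt (by norm_num)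
      have hqy : DifferentiableAt ℝ q y := hqs.differentiable (by norm_num) y
      simp only [z, gradient, fderiv_fun_add hwy hqy, map_add]
    have hq : gradient q = fun y => (2 * ε) • y := funext fun y => gradient_norm_sq ε 0 y
    have h3 : divergence (gradient z) p = 2 * ε * d := by
      rw [divergence_congr h2, divergence_add
        ((contDiffAt_gradient (hw p hpO)).differentiableAt (by norm_num))
        ((contDiffAt_gradient hqs.contDiffAt).differentiableAt (by norm_num)), hΔ p hpO, hq,
        divergence_const_smul_id, zero_add]
    have h4 : (0 : ℝ) < d := by exact_mod_cast hd
    rw [h3] at h1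
    have : 0 < 2 * ε * d := by positivity
    linarith
  · have hpf : p ∈ frontier (O : Set (EuclideanSpace ℝ (Fin d))) := by
      rw [O.isOpen.frontier_eq]
      exact ⟨hp, hpO⟩
    have h1 := hb p hpf
    have h2 : ‖p‖ ^ 2 ≤ R ^ 2 := by
      have := hR p hp
      gcongr
    have h3 : z p = w p + ε * ‖p‖ ^ 2 := by simp [z, q]
    nlinarith

theorem IsClassicalSolution.contDiffAt {θ f g u : EuclideanSpace ℝ (Fin d) → ℝ}
    (hu : IsClassicalSolution O θ f g u) {x : EuclideanSpace ℝ (Fin d)} (hx : x ∈ O) :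
    ContDiffAt ℝ 2 u x :=
  (hu.smooth.contDiffAt (O.isOpen.mem_nhds hx)).of_le (by norm_cast)

theorem IsClassicalSolution.le {f g u v : EuclideanSpace ℝ (Fin d) → ℝ} (hd : 0 < d)
    (hO : Bornology.IsBounded (O : Set (EuclideanSpace ℝ (Fin d))))
    (hu : IsClassicalSolution O (fun _ => 1) f g u)
    (hv : IsClassicalSolution O (fun _ => 1) f g v) :
    ∀ x ∈ O, u x ≤ v x := by
  intro x hx
  refine sub_nonpos.1 (nonpos_of_harmonic_of_boundary (w := fun y => u y - v y) hd hO
    (fun y hy => (hu.contDiffAt hy).sub (hv.contDiffAt hy)) (hu.continuous.sub hv.continuous)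
    (fun y hy => ?_) (fun y hy => by simp [hu.boundary y hy, hv.boundary y hy]) x hx)
  have h2 : gradient (fun y => u y - v y) =ᶠ[𝓝 y] fun y => gradient u y - gradient v y := by
    filter_upwards [O.isOpen.mem_nhds hy] with a ha
    have h3 := (hu.contDiffAt ha).differentiableAt (by norm_num)
    have h4 := (hv.contDiffAt ha).differentiableAt (by norm_num)
    simp only [gradient, fderiv_fun_sub h3 h4, map_sub]
  rw [divergence_congr h2, divergence_sub
    ((contDiffAt_gradient (hu.contDiffAt hy)).differentiableAt (by norm_num))
    ((contDiffAt_gradient (hv.contDiffAt hy)).differentiableAt (by norm_num))]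
  have h5 := hu.equation y hy
  have h6 := hv.equation y hy
  simp only [one_smul] at h5 h6
  change divergence (gradient u) y - divergence (gradient v) y = 0
  rw [show gradient u = fun y => gradient u y from rfl,
    show gradient v = fun y => gradient v y from rfl, h5, h6, sub_self]

/-- Uniqueness of classical solutions of the Poisson equation. -/
theorem IsClassicalSolution.eqOn {f g u v : EuclideanSpace ℝ (Fin d) → ℝ} (hd : 0 < d)
    (hO : Bornology.IsBounded (O : Set (EuclideanSpace ℝ (Fin d))))
    (hu : IsClassicalSolution O (fun _ => 1) f g u)
    (hv : IsClassicalSolution O (fun _ => 1) f g v) : Set.EqOn u v O :=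
  fun x hx => le_antisymm (hu.le hd hO hv x hx) (hv.le hd hO hu x hx)

theorem gradient_half_norm_sq (x : EuclideanSpace ℝ (Fin d)) :
    gradient (fun x : EuclideanSpace ℝ (Fin d) => (‖x‖ ^ 2 - 1) / 2) x = x := by
  have h : (fun x : EuclideanSpace ℝ (Fin d) => (‖x‖ ^ 2 - 1) / 2)
      = fun x => 1 / 2 * ‖x‖ ^ 2 + -1 / 2 := by
    ext x
    ring
  rw [h, gradient_norm_sq]
  norm_num

theorem isClassicalSolution_half_norm_sq :
    IsClassicalSolution O (fun _ => 1) (fun _ => d) (fun x => (‖x‖ ^ 2 - 1) / 2)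
      (fun x => (‖x‖ ^ 2 - 1) / 2) where
  smooth := (((contDiff_norm_sq ℝ).sub contDiff_const).div_const 2).contDiffOn
  continuous := by fun_prop
  equation x _ := by
    simp only [gradient_half_norm_sq]
    rw [divergence_const_smul_id, one_mul]
  boundary _ _ := rfl

/-! ### The position field and the Poincaré inequality on the disk -/

theorem mem_unitDisk {x : EuclideanSpace ℝ (Fin 2)} : x ∈ unitDisk ↔ ‖x‖ < 1 :=
  mem_ball_zero_iff

theorem ae_mem_unitDisk :
    ∀ᵐ x ∂(volume.restrict (unitDisk : Set (EuclideanSpace ℝ (Fin 2)))), ‖x‖ < 1 := by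
  filter_upwards [ae_restrict_mem unitDisk.isOpen.measurableSet] with x hx
  exact mem_unitDisk.1 hx

theorem isBounded_unitDisk :
    Bornology.IsBounded (unitDisk : Set (EuclideanSpace ℝ (Fin 2))) :=
  Metric.isBounded_ball

instance : IsFiniteMeasure
    (volume.restrict (unitDisk : Set (EuclideanSpace ℝ (Fin 2)))) :=
  ⟨by simpa using isBounded_unitDisk.measure_lt_top⟩

theorem smul_position_ae_le (h : L2 unitDisk) :
    ∀ᵐ x ∂(volume.restrict (unitDisk : Set (EuclideanSpace ℝ (Fin 2)))),
      ‖h x • x‖ ≤ ‖h x‖ := by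
  filter_upwards [ae_mem_unitDisk] with x hx
  rw [norm_smul]
  exact mul_le_of_le_one_right (norm_nonneg _) hx.le

theorem smul_position_memLp (h : L2 unitDisk) :
    MemLp (fun x => h x • x) 2
      (volume.restrict (unitDisk : Set (EuclideanSpace ℝ (Fin 2)))) :=
  (Lp.memLp h).of_le ((Lp.aestronglyMeasurable h).smul aestronglyMeasurable_id)
    (smul_position_ae_le h)

/-- Multiplication of a square integrable function on the disk by the position field. -/
def smulPosition : L2 unitDisk →L[ℝ] L2Vec unitDisk :=
  LinearMap.mkContinuous
    { toFun := fun h => (smul_position_memLp h).toLp _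
      map_add' := fun h k => by
        rw [← MemLp.toLp_add]
        refine MemLp.toLp_congr _ _ ?_
        filter_upwards [Lp.coeFn_add h k] with x hx
        rw [hx, Pi.add_apply, Pi.add_apply, add_smul]
      map_smul' := fun c h => by
        rw [RingHom.id_apply, ← MemLp.toLp_const_smul]
        refine MemLp.toLp_congr _ _ ?_
        filter_upwards [Lp.coeFn_smul c h] with x hx
        rw [hx, Pi.smul_apply, Pi.smul_apply, smul_assoc] }
    1 fun h => by
      rw [one_mul]
      refine Lp.norm_le_norm_of_ae_le ?_
      filter_upwards [(smul_position_memLp h).coeFn_toLp, smul_position_ae_le h] with x h1 h2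
      exact (congrArg norm h1).trans_le h2

theorem coeFn_smulPosition (h : L2 unitDisk) :
    smulPosition h =ᵐ[volume.restrict (unitDisk : Set (EuclideanSpace ℝ (Fin 2)))]
      fun x => h x • x :=
  (smul_position_memLp h).coeFn_toLp

theorem norm_smulPosition_le (h : L2 unitDisk) : ‖smulPosition h‖ ≤ ‖h‖ := by
  simpa using (smulPosition.le_of_opNorm_le (LinearMap.mkContinuous_norm_le _ zero_le_one _) h)

theorem inner_smulPosition_gradLM (h : L2 unitDisk) (φ : Test unitDisk) :
    inner ℝ (smulPosition h) (gradLM unitDisk φ)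
      = ∫ x in (unitDisk : Set (EuclideanSpace ℝ (Fin 2))), h x * fderiv ℝ φ x x := by
  rw [inner_gradLM]
  refine integral_congr_ae ?_
  filter_upwards [coeFn_smulPosition h] with x hx
  rw [hx, real_inner_smul_left, inner_gradient]

theorem divergence_smul_id {d : ℕ} {φ : EuclideanSpace ℝ (Fin d) → ℝ}
    {x : EuclideanSpace ℝ (Fin d)} (hφ : DifferentiableAt ℝ φ x) :
    divergence (fun y => φ y • y) x = d * φ x + fderiv ℝ φ x x := by
  have h : fderiv ℝ (fun y => φ y • y) x
      = φ x • ContinuousLinearMap.id ℝ _ + (fderiv ℝ φ x).smulRight x := by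
    rw [fderiv_fun_smul hφ differentiableAt_fun_id, fderiv_fun_id]
  rw [divergence, h, ← inner_gradient, PiLp.inner_apply]
  simp [Finset.sum_add_distrib, gradient_apply]

/-- Testing $\nabla\cdot(\varphi x)=2\varphi+x\cdot\nabla\varphi$ against $\varphi$ gives
$\|\varphi\|^2=-\langle\varphi x,\nabla\varphi\rangle\le\|\varphi\|\,\|\nabla\varphi\|$, as $|x|<1$.
Hence the constant $1$. -/
theorem hasPoincare_unitDisk : HasPoincare unitDisk := by
  refine ⟨1, fun φ => ?_⟩
  have hφ := test_contDiff_one φ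
  have h := setIntegral_divergence_mul (O := unitDisk) (X := fun x => φ x • x) (hφ.smul contDiff_id) φ
  have h1 : ∫ x in (unitDisk : Set (EuclideanSpace ℝ (Fin 2))), φ x * φ x
      = ‖testLM unitDisk φ‖ ^ 2 := by
    rw [← real_inner_self_eq_norm_sq, inner_testLM]
    refine integral_congr_ae ?_
    filter_upwards [coeFn_testLM φ] with x hx
    rw [hx]
  have h2 : ∫ x in (unitDisk : Set (EuclideanSpace ℝ (Fin 2))), φ x * fderiv ℝ φ x x
      = inner ℝ (smulPosition (testLM unitDisk φ)) (gradLM unitDisk φ) := by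
    rw [inner_smulPosition_gradLM]
    refine integral_congr_ae ?_
    filter_upwards [coeFn_testLM φ] with x hx
    rw [hx]
  have hf : Continuous fun x => fderiv ℝ φ x x :=
    (hφ.continuous_fderiv (by norm_num)).clm_apply continuous_id
  have i1 : Integrable (fun x => φ x * φ x)
      (volume.restrict (unitDisk : Set (EuclideanSpace ℝ (Fin 2)))) :=
    (Continuous.integrable_of_hasCompactSupport (by fun_prop)
      φ.hasCompactSupport.mul_left).integrableOn
  have i2 : Integrable (fun x => φ x * fderiv ℝ φ x x)
      (volume.restrict (unitDisk : Set (EuclideanSpace ℝ (Fin 2)))) :=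
    (Continuous.integrable_of_hasCompactSupport (by fun_prop)
      φ.hasCompactSupport.mul_right).integrableOn
  have h3 : ∫ x in (unitDisk : Set (EuclideanSpace ℝ (Fin 2))),
      divergence (fun y => φ y • y) x * φ x
      = 2 * ‖testLM unitDisk φ‖ ^ 2
        + inner ℝ (smulPosition (testLM unitDisk φ)) (gradLM unitDisk φ) := by
    rw [← h1, ← h2, ← integral_const_mul, ← integral_add (i1.const_mul 2) i2]
    refine integral_congr_ae (Eventually.of_forall fun x => ?_)
    have := divergence_smul_id (hφ.differentiable (by norm_num) x)
    simp only [this]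
    push_cast
    ring
  have h4 : ∫ x in (unitDisk : Set (EuclideanSpace ℝ (Fin 2))),
      inner ℝ (φ x • x) (gradient φ x)
      = inner ℝ (smulPosition (testLM unitDisk φ)) (gradLM unitDisk φ) := by
    simp only [← h2, real_inner_smul_left, inner_gradient]
  rw [h3, h4] at h
  have h5 := abs_real_inner_le_norm (smulPosition (testLM unitDisk φ)) (gradLM unitDisk φ)
  have h6 := mul_le_mul_of_nonneg_right (norm_smulPosition_le (testLM unitDisk φ))
    (norm_nonneg (gradLM unitDisk φ))
  have h7 := neg_le_of_abs_le h5
  rw [one_mul]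
  by_contra! hlt
  have h8 : 0 < ‖testLM unitDisk φ‖ := (norm_nonneg _).trans_lt hlt
  nlinarith

/-! ### Dilations and fields $hx$ with vanishing divergence -/

/-- The dilate `x ↦ φ (r x)`, `r ≥ 1`, of a test function on the disk. -/
def dilate (φ : Test unitDisk) (r : ℝ) (hr : 1 ≤ r) : Test unitDisk where
  toFun x := φ (r • x)
  contDiff' := φ.contDiff.comp (contDiff_const_smul r)
  hasCompactSupport' := φ.hasCompactSupport.comp_smul (by positivity)
  tsupport_subset' := by
    intro x hx
    have h1 : r • x ∈ tsupport φ :=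
      tsupport_comp_subset_preimage φ (continuous_const_smul r) hx
    have h2 : ‖r • x‖ < 1 := mem_unitDisk.1 (φ.tsupport_subset h1)
    refine mem_unitDisk.2 (lt_of_le_of_lt ?_ h2)
    rw [norm_smul, Real.norm_of_nonneg (by positivity)]
    exact le_mul_of_one_le_left (norm_nonneg _) hr

theorem fderiv_dilate (φ : Test unitDisk) {r : ℝ} (hr : 1 ≤ r)
    (x : EuclideanSpace ℝ (Fin 2)) :
    fderiv ℝ (dilate φ r hr) x x = r * fderiv ℝ φ (r • x) x := by
  have h : HasFDerivAt φ (fderiv ℝ φ (r • x)) (r • x) :=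
    ((test_contDiff_one φ).differentiable (by norm_num) _).hasFDerivAt
  have h1 := h.comp x ((hasFDerivAt_id x).const_smul r)
  have h2 : fderiv ℝ (dilate φ r hr) x = _ := h1.fderiv
  rw [h2]
  simp

/-- Differentiation under the integral: on the disk $|x|<1$, so the derivative is dominated by
$|h|\sup\|D\varphi\|$, integrable since the disk has finite measure. -/
theorem hasDerivAt_integral_dilate (h : L2 unitDisk) (φ : Test unitDisk) (r : ℝ) :
    HasDerivAt
      (fun r : ℝ => ∫ x in (unitDisk : Set (EuclideanSpace ℝ (Fin 2))), h x * φ (r • x))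
      (∫ x in (unitDisk : Set (EuclideanSpace ℝ (Fin 2))), h x * fderiv ℝ φ (r • x) x) r := by
  have hφ := test_contDiff_one φ
  have hf : Continuous (fderiv ℝ φ) := hφ.continuous_fderiv (by norm_num)
  obtain ⟨C, hC⟩ := hf.bounded_above_of_compact_support (φ.hasCompactSupport.fderiv (𝕜 := ℝ))
  obtain ⟨B, hB⟩ := φ.continuous.bounded_above_of_compact_support φ.hasCompactSupport
  have hh : Integrable h (volume.restrict (unitDisk : Set (EuclideanSpace ℝ (Fin 2)))) :=
    (Lp.memLp h).integrable (by norm_num)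
  have hm := hh.aestronglyMeasurable
  refine (hasDerivAt_integral_of_dominated_loc_of_deriv_le
    (F' := fun r x => h x * fderiv ℝ φ (r • x) x) (bound := fun x => ‖h x‖ * C)
    univ_mem (Eventually.of_forall fun s => ?_) ?_ ?_ ?_ (hh.norm.mul_const C) ?_).2
  · exact hm.mul (φ.continuous.comp (continuous_const_smul s)).aestronglyMeasurable
  · exact hh.mul_bdd (c := B) (φ.continuous.comp (continuous_const_smul r)).aestronglyMeasurable
      (Eventually.of_forall fun x => hB _)
  · exact hm.mul ((hf.comp (continuous_const_smul r)).clm_apply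
      continuous_id).aestronglyMeasurable
  · filter_upwards [ae_mem_unitDisk] with x hx s _
    rw [norm_mul]
    have hC0 : 0 ≤ C := (norm_nonneg _).trans (hC 0)
    gcongr
    calc ‖fderiv ℝ φ (s • x) x‖ ≤ C * ‖x‖ := (fderiv ℝ φ (s • x)).le_of_opNorm_le (hC _) x
      _ ≤ C := mul_le_of_le_one_right hC0 hx.le
  · refine Eventually.of_forall fun x s _ => ?_
    have h1 : HasFDerivAt φ (fderiv ℝ φ (s • x)) (s • x) :=
      (hφ.differentiable (by norm_num) _).hasFDerivAt
    have h2 : HasDerivAt (fun s : ℝ => s • x) x s := by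
      simpa using (hasDerivAt_id s).smul_const x
    exact (h1.comp_hasDerivAt s h2).const_mul (h x)

theorem tendsto_integral_dilate (h : L2 unitDisk) (φ : Test unitDisk) :
    Tendsto
      (fun r : ℝ => ∫ x in (unitDisk : Set (EuclideanSpace ℝ (Fin 2))), h x * φ (r • x))
      atTop (𝓝 0) := by
  obtain ⟨B, hB⟩ := φ.continuous.bounded_above_of_compact_support φ.hasCompactSupport
  have hh : Integrable h (volume.restrict (unitDisk : Set (EuclideanSpace ℝ (Fin 2)))) :=
    (Lp.memLp h).integrable (by norm_num)
  have hne : ∀ᵐ x ∂(volume.restrict (unitDisk : Set (EuclideanSpace ℝ (Fin 2)))), x ≠ 0 :=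
    compl_mem_ae_iff.2 (measure_singleton 0)
  have key := tendsto_integral_filter_of_dominated_convergence (l := atTop)
    (μ := volume.restrict (unitDisk : Set (EuclideanSpace ℝ (Fin 2))))
    (F := fun (r : ℝ) x => h x * φ (r • x)) (f := fun _ => 0) (fun x => ‖h x‖ * B)
    (Eventually.of_forall fun s => hh.aestronglyMeasurable.mul
      (φ.continuous.comp (continuous_const_smul s)).aestronglyMeasurable)
    (Eventually.of_forall fun s => Eventually.of_forall fun x => by
      rw [norm_mul]
      gcongr
      exact hB _) (hh.norm.mul_const B) ?_
  · simpa using key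
  · filter_upwards [hne] with x hx
    refine tendsto_const_nhds.congr' ?_
    -- Once $r\ge1/|x|$, the point $rx$ has left the disk and hence the support of `φ`.
    filter_upwards [eventually_ge_atTop ‖x‖⁻¹] with r hr
    have hx' : 0 < ‖x‖ := norm_pos_iff.2 hx
    have h1 : r • x ∉ tsupport φ := fun hmem => by
      have h2 : ‖r • x‖ < 1 := mem_unitDisk.1 (φ.tsupport_subset hmem)
      rw [norm_smul, Real.norm_of_nonneg ((inv_nonneg.2 hx'.le).trans hr)] at h2
      exact absurd ((inv_le_iff_one_le_mul₀ hx').1 hr) (not_le.2 h2)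
    rw [image_eq_zero_of_notMem_tsupport h1, mul_zero]

/-- A square integrable `h` on the disk with `∇ · (h x) = 0` in the sense of distributions
vanishes. -/
theorem eq_zero_of_inner_smulPosition_gradLM {h : L2 unitDisk}
    (hh : ∀ φ : Test unitDisk, inner ℝ (smulPosition h) (gradLM unitDisk φ) = 0) : h = 0 := by
  refine eq_zero_of_inner_testLM fun φ => ?_
  rw [inner_testLM]
  set F : ℝ → ℝ := fun r => ∫ x in (unitDisk : Set (EuclideanSpace ℝ (Fin 2))), h x * φ (r • x)
    with hF
  -- Testing with the dilate gives $r\,F'(r)=0$. The bound $r\ge1$ keeps its support inside the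
  -- disk.
  have hd : ∀ r, 1 ≤ r → HasDerivAt F 0 r := fun r hr => by
    have h1 := hh (dilate φ r hr)
    simp only [inner_smulPosition_gradLM, fderiv_dilate, mul_left_comm _ r,
      integral_const_mul] at h1
    have h2 := hasDerivAt_integral_dilate h φ r
    rwa [(mul_eq_zero.1 h1).resolve_left (by positivity)] at h2
  have hconst : ∀ r, 1 ≤ r → F r = F 1 := fun r hr =>
    constant_of_has_deriv_right_zero
      (fun s hs => (hd s hs.1).continuousAt.continuousWithinAt)
      (fun s hs => (hd s hs.1).hasDerivWithinAt) r ⟨hr, le_rfl⟩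
  have hlim : Tendsto F atTop (𝓝 (F 1)) :=
    tendsto_const_nhds.congr' (by
      filter_upwards [eventually_ge_atTop 1] with r hr
      exact (hconst r hr).symm)
  have h1 : F 1 = 0 := tendsto_nhds_unique hlim (tendsto_integral_dilate h φ)
  simpa [hF] using h1

/-! ### Identification and injectivity of the linearised map -/

/-- The linearisation at `θ = 1`, as the flux response to `h x`. -/
def linearisedMap : L2 unitDisk →L[ℝ] L2 unitDisk :=
  fluxResponse unitDisk ∘L smulPosition

theorem injective_linearisedMap : Function.Injective linearisedMap := by
  refine (injective_iff_map_eq_zero linearisedMap).2 fun h hh => ?_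
  exact eq_zero_of_inner_smulPosition_gradLM
    (inner_gradLM_eq_zero_of_fluxResponse_eq_zero hasPoincare_unitDisk hh)

theorem linearisedMap_testL2 {u : EuclideanSpace ℝ (Fin 2) → ℝ}
    (hu : ContDiffOn ℝ ∞ u unitDisk) (hg : ∀ x ∈ unitDisk, gradient u x = x)
    (h : Test unitDisk) :
    linearisedMap (testL2 unitDisk h) = -laplaceInverse unitDisk (divFluxL2 unitDisk hu h) := by
  refine fluxResponse_eq_neg_laplaceInverse hasPoincare_unitDisk fun φ => ?_
  have h1 := setIntegral_divergence_mul (contDiff_smul_gradient unitDisk hu h) φ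
  rw [inner_testLM, inner_gradLM, integral_congr_ae (g := fun x =>
    divergence (fun x => h x • gradient u x) x * φ x) ?_, h1, integral_congr_ae]
  · filter_upwards [ae_restrict_mem unitDisk.isOpen.measurableSet, coeFn_testLM h,
      coeFn_smulPosition (testL2 unitDisk h)] with x hx h2 h3
    have h2' : testL2 unitDisk h x = h x := h2
    rw [h2'] at h3
    rw [hg x hx]
    exact congrArg (inner ℝ · (gradient φ x)) h3.symm
  · filter_upwards [(divergence_memLp unitDisk hu h).coeFn_toLp] with x hx
    rw [divFluxL2, hx]

/-- Any admissible `u` agrees with $(|x|^2-1)/2$ on the disk and any admissible `V` is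
`laplaceInverse`, so `I` is forced on test functions and then everywhere by density. -/
theorem isLinearisedMap_iff {I : L2 unitDisk →L[ℝ] L2 unitDisk} :
    IsLinearisedMap unitDisk (fun _ => 1) (fun _ => 2) (fun x => (‖x‖ ^ 2 - 1) / 2) I ↔
      I = linearisedMap := by
  have h0 : IsClassicalSolution unitDisk (fun _ => 1) (fun _ => 2)
      (fun x => (‖x‖ ^ 2 - 1) / 2) (fun x => (‖x‖ ^ 2 - 1) / 2) := by
    simpa using isClassicalSolution_half_norm_sq (O := unitDisk)
  constructor
  · rintro ⟨u, hu, V, hV, hI⟩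
    rw [isDirichletInverse_one_iff hasPoincare_unitDisk] at hV
    have heq : Set.EqOn u (fun x => (‖x‖ ^ 2 - 1) / 2) unitDisk :=
      hu.eqOn two_pos isBounded_unitDisk h0
    have hg : ∀ x ∈ unitDisk, gradient u x = x := fun x hx => by
      have h1 := (heq.eventuallyEq_of_mem (unitDisk.isOpen.mem_nhds hx)).fderiv_eq (𝕜 := ℝ)
      rw [gradient, h1]
      exact gradient_half_norm_sq x
    refine ContinuousLinearMap.ext fun F => ?_
    refine congrFun (denseRange_testLM.equalizer I.continuous linearisedMap.continuous ?_) F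
    funext h
    exact (hI h).trans (by rw [hV, ← linearisedMap_testL2 hu.smooth hg]; rfl)
  · rintro rfl
    exact ⟨_, h0, laplaceInverse unitDisk,
      (isDirichletInverse_one_iff hasPoincare_unitDisk).2 rfl,
      linearisedMap_testL2 h0.smooth fun x _ => gradient_half_norm_sq x⟩

end DivForm

end

theorem mainTheorem7 :
    (∃! I : DivForm.L2 DivForm.unitDisk →L[ℝ] DivForm.L2 DivForm.unitDisk,
      DivForm.IsLinearisedMap DivForm.unitDisk
        (fun _ => 1) (fun _ => 2) (fun x => (‖x‖ ^ 2 - 1) / 2) I) ∧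
    ∀ I : DivForm.L2 DivForm.unitDisk →L[ℝ] DivForm.L2 DivForm.unitDisk,
      DivForm.IsLinearisedMap DivForm.unitDisk
        (fun _ => 1) (fun _ => 2) (fun x => (‖x‖ ^ 2 - 1) / 2) I →
      Function.Injective I := by
  simp only [DivForm.isLinearisedMap_iff]
  exact ⟨⟨_, rfl, fun _ h => h⟩, fun I hI => hI ▸ DivForm.injective_linearisedMap⟩
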